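/- Terms are variables or constants, and an atom is $p(t_1,\dots,t_k)$ with $p$ a predicate of arity $k$ and terms $t_i$. An existential rule $r=B\to H$ stands for $\forall \vec x\,\forall\vec y\,(B[\vec x,\vec y]\to\exists \vec z\,H[\vec x,\vec z])$, with $B,H$ non-empty finite conjunctions of atoms; $\vec x$ are its frontier variables and $\vec z$ its existential variables. A knowledge base $(\mathcal F,\mathcal R)$ is a finite set $\mathcal F$ of variable-free atoms with a finite set $\mathcal R$ of existential rules. An atomic CQ is the existential closure of a single atom. A transitivity rule is a rule $p(x,y)\wedge p(y,z)\to p(x,z)$. For a rule set $\mathcal R$, take fresh predicates $F_{r,y}$ (unary), $S,D$ (binary), $C$ (nullary) and fresh constants $*$ and $c_{r,y}$, for $r\in\mathcal R$ and $y$ an existential variable of $r$. Let $\mathrm{MSA}(\mathcal R)$ consist of the rules $$B\to\Bigl(H\wedge\bigwedge_{y}\bigl(F_{r,y}(y)\wedge\bigwedge_{x}S(x,y)\bigr)\Bigr)[y\mapsto c_{r,y}]$$ for $r=B\to H$ in $\mathcal R$ ($y$ ranging over its existential and $x$ over its frontier variables), the rules $S(x,y)\to D(x,y)$ and $D(x,y)\wedge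 S(y,z)\to D(x,z)$, and the rules $F_{r,y}(x)\wedge D(x,x')\wedge F_{r,y}(x')\to C$. Let $I^*_{\mathcal R}$ be the set of all facts over the predicates occurring in $\mathcal R$ and the constants occurring in $\mathcal R$ together with $*$. The set $\mathcal R$ is model-summarizing acyclic (msa) if $I^*_{\mathcal R}\cup\mathrm{MSA}(\mathcal R)\not\models C$. A rule set is in msa+trans if it is the union of an msa rule set and a set of transitivity rules. **Proposition.** Atomic CQ entailment over msa+trans knowledge bases is undecidable: no algorithm, given a knowledge base $(\mathcal F,\mathcal R)$ with $\mathcal R$ in msa+trans and an atomic CQ $Q$, always halts and correctly answers whether $(\mathcal F,\mathcal R)\models Q$. -/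

import Mathlib

namespace ExRules

/-- Terms over a set `K` of constants: a constant `Sum.inl c` or a variable `Sum.inr x`. -/
abbrev Term (K : Type) : Type := K ⊕ ℕ

/-- An atom `p(t₁, …, t_k)`: a predicate name and the list of its arguments. A predicate is a name
together with an arity, so the same name with lists of different lengths denotes different
predicates; there are infinitely many predicates of each arity as soon as `P` is infinite. -/
abbrev Atom (P K : Type) : Type := P × List (Term K)

/-- An existential rule `B → H`, as the pair of its body `B` and its head `H`, both finite
conjunctions of atoms. Variables are implicitly quantified, see `Interp.SatRule`. -/
abbrev Rule (P K : Type) : Type := List (Atom P K) × List (Atom P K)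

variable {P K : Type}

/-- The variable `x` occurs in the conjunction `A`. -/
def VarIn (x : ℕ) (A : List (Atom P K)) : Prop := ∃ a ∈ A, Sum.inr x ∈ a.2

/-- The constant `c` occurs in the conjunction `A`. -/
def ConstIn (c : K) (A : List (Atom P K)) : Prop := ∃ a ∈ A, Sum.inl c ∈ a.2

/-- Frontier variables occur in the body and in the head. -/
def IsFrontier (r : Rule P K) (x : ℕ) : Prop := VarIn x r.1 ∧ VarIn x r.2

/-- Existential variables occur in the head only. -/
def IsExistential (r : Rule P K) (x : ℕ) : Prop := ¬ VarIn x r.1 ∧ VarIn x r.2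

/-- A fact is an atom without variables. -/
def IsFact (a : Atom P K) : Prop := ∀ x : ℕ, Sum.inr x ∉ a.2

/-! ### First-order semantics -/

/-- A first-order interpretation with domain `D` (non-empty whenever `K` is). -/
structure Interp (P K D : Type) where
  const : K → D
  rel : P → List D → Prop

namespace Interp

variable {D : Type} (I : Interp P K D)

/-- The value of a term under a variable assignment. -/
def val (v : ℕ → D) : Term K → D
  | Sum.inl c => I.const c
  | Sum.inr x => v x

def SatAtom (v : ℕ → D) (a : Atom P K) : Prop := I.rel a.1 (a.2.map (I.val v))

def SatConj (v : ℕ → D) (A : List (Atom P K)) : Prop := ∀ a ∈ A, I.SatAtom v a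

/-- `I ⊨ ∀ x y, (B[x, y] → ∃ z, H[x, z])`. -/
def SatRule (r : Rule P K) : Prop :=
  ∀ v : ℕ → D, I.SatConj v r.1 →
    ∃ w : ℕ → D, (∀ x, VarIn x r.1 → w x = v x) ∧ I.SatConj w r.2

/-- `I ⊨ Q` for a Boolean conjunctive query `Q`, the existential closure of a conjunction. -/
def SatCQ (Q : List (Atom P K)) : Prop := ∃ v : ℕ → D, I.SatConj v Q

end Interp

/-- Logical entailment `(F, R) ⊨ Q` of a Boolean conjunctive query: `Q` holds in every model of
the facts `F` and the rules `R`. (A fact has no variables, so it is the same as the conjunctive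
query that consists of it.) -/
def Entails (F : Set (Atom P K)) (R : Set (Rule P K)) (Q : List (Atom P K)) : Prop :=
  ∀ (D : Type) (I : Interp P K D),
    (∀ a ∈ F, I.SatCQ [a]) → (∀ r ∈ R, I.SatRule r) → I.SatCQ Q

/-! ### Model-summarizing acyclicity -/

/-- Predicates of the summarizing program: those of the rule set, a unary predicate `F_{r,y}` for
each rule `r` and existential variable `y` of `r`, binary predicates `S` and `D`, and a nullary
predicate `C`. -/
inductive MSAPred (P K : Type) : Type
  | orig (p : P)
  | F (r : Rule P K) (y : ℕ)
  | S
  | D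
  | C

/-- Constants of the summarizing program: those of the rule set, the constant `∗` of the critical
instance, and a constant `c_{r,y}` for each rule `r` and existential variable `y` of `r`. -/
inductive MSAConst (P K : Type) : Type
  | orig (c : K)
  | star
  | sk (r : Rule P K) (y : ℕ)

/-- The embedding of terms over `K`, which keeps the variables. -/
def liftTerm : Term K → Term (MSAConst P K)
  | Sum.inl c => Sum.inl (MSAConst.orig c)
  | Sum.inr x => Sum.inr x

open Classical in
/-- The embedding of the terms of `r`, with each variable `y` that is not in the body replaced by
the constant `c_{r,y}`. -/
noncomputable def skTerm (r : Rule P K) : Term K → Term (MSAConst P K)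
  | Sum.inl c => Sum.inl (MSAConst.orig c)
  | Sum.inr x => if VarIn x r.1 then Sum.inr x else Sum.inl (MSAConst.sk r x)

/-- The body of `r`, embedded into the vocabulary of the summarizing program. -/
def msaBody (r : Rule P K) : List (Atom (MSAPred P K) (MSAConst P K)) :=
  r.1.map fun a => (MSAPred.orig a.1, a.2.map liftTerm)

/-- The rule `B → H` with `c_{r,y}` substituted for each existential variable `y`. -/
noncomputable def msaMain (r : Rule P K) : Rule (MSAPred P K) (MSAConst P K) :=
  (msaBody r, r.2.map fun a => (MSAPred.orig a.1, a.2.map (skTerm r)))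

/-- The summarizing program of a rule set. The rule
`B → H ∧ ⋀_y (F_{r,y}(y) ∧ ⋀_x S(x, y))`, where `y` ranges over the existential and `x` over the
frontier variables of `r` and `c_{r,y}` is substituted for each `y`, is given here by one rule
with body `B` for each part of the head. -/
inductive MSAProgram (R : Set (Rule P K)) : Rule (MSAPred P K) (MSAConst P K) → Prop
  | main (r : Rule P K) (hr : r ∈ R) : MSAProgram R (msaMain r)
  | mark (r : Rule P K) (hr : r ∈ R) (y : ℕ) (hy : IsExistential r y) :
      MSAProgram R (msaBody r, [(MSAPred.F r y, [Sum.inl (MSAConst.sk r y)])])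
  | succ (r : Rule P K) (hr : r ∈ R) (y : ℕ) (hy : IsExistential r y)
      (x : ℕ) (hx : IsFrontier r x) :
      MSAProgram R (msaBody r, [(MSAPred.S, [Sum.inr x, Sum.inl (MSAConst.sk r y)])])
  -- `S(x, y) → D(x, y)`
  | base : MSAProgram R
      ([(MSAPred.S, [Sum.inr 0, Sum.inr 1])], [(MSAPred.D, [Sum.inr 0, Sum.inr 1])])
  -- `D(x, y) ∧ S(y, z) → D(x, z)`
  | step : MSAProgram R
      ([(MSAPred.D, [Sum.inr 0, Sum.inr 1]), (MSAPred.S, [Sum.inr 1, Sum.inr 2])],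
        [(MSAPred.D, [Sum.inr 0, Sum.inr 2])])
  -- `F_{r,y}(x) ∧ D(x, x') ∧ F_{r,y}(x') → C`
  | cycle (r : Rule P K) (hr : r ∈ R) (y : ℕ) (hy : IsExistential r y) : MSAProgram R
      ([(MSAPred.F r y, [Sum.inr 0]), (MSAPred.D, [Sum.inr 0, Sum.inr 1]),
        (MSAPred.F r y, [Sum.inr 1])], [(MSAPred.C, [])])

/-- The constants of the critical instance: `∗` and the constants that occur in `R`. -/
inductive CritConst (R : Set (Rule P K)) : MSAConst P K → Prop
  | star : CritConst R MSAConst.star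
  | orig (c : K) (r : Rule P K) (hr : r ∈ R) (hc : ConstIn c (r.1 ++ r.2)) :
      CritConst R (MSAConst.orig c)

/-- The critical instance of `R`: all facts over the predicates that occur in `R` (with the arity
with which they occur) and the constants `CritConst R`. -/
def criticalInstance (R : Set (Rule P K)) : Set (Atom (MSAPred P K) (MSAConst P K)) :=
  {a | ∃ r ∈ R, ∃ b ∈ r.1 ++ r.2, a.1 = MSAPred.orig b.1 ∧ a.2.length = b.2.length ∧
    ∀ t ∈ a.2, ∃ c, CritConst R c ∧ t = Sum.inl c}

/-- `R` is model-summarizing acyclic: the summarizing program does not derive `C` from the critical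
instance. -/
def IsMSA (R : Set (Rule P K)) : Prop :=
  ¬ Entails (criticalInstance R) {ρ | MSAProgram R ρ} [(MSAPred.C, [])]

/-! ### The decision problem -/

/-- `p(x, y) ∧ p(y, z) → p(x, z)` with distinct variables `x`, `y`, `z`. -/
def IsTransitivityRule (r : Rule P K) : Prop :=
  ∃ (p : P) (x y z : ℕ), x ≠ y ∧ x ≠ z ∧ y ≠ z ∧
    r = ([(p, [Sum.inr x, Sum.inr y]), (p, [Sum.inr y, Sum.inr z])], [(p, [Sum.inr x, Sum.inr z])])

/-- `R` belongs to the class msa+trans: it is the union of an msa set and a set of transitivity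
rules. -/
def IsMSAPlusTrans (R : Set (Rule P K)) : Prop :=
  ∃ R₀ T : Set (Rule P K), R = R₀ ∪ T ∧ IsMSA R₀ ∧ ∀ r ∈ T, IsTransitivityRule r

/-- An instance of atomic query entailment: a finite fact base, a finite rule set, and an atomic
query. Predicate names and constants are natural numbers. -/
abbrev Instance : Type := List (Atom ℕ ℕ) × List (Rule ℕ ℕ) × Atom ℕ ℕ

/-- The instance is over an msa+trans knowledge base: its fact base consists of facts, its rules
have non-empty bodies and heads, and its rule set is in msa+trans. -/
def Instance.OverMSAPlusTrans (i : Instance) : Prop :=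
  (∀ a ∈ i.1, IsFact a) ∧ (∀ r ∈ i.2.1, r.1 ≠ [] ∧ r.2 ≠ []) ∧ IsMSAPlusTrans {r | r ∈ i.2.1}

/-- The knowledge base of the instance entails its query. -/
def Instance.Entailed (i : Instance) : Prop :=
  Entails {a | a ∈ i.1} {r | r ∈ i.2.1} [i.2.2]

/-- The problem `p`, restricted to the inputs that satisfy `dom`, is decidable: some algorithm
halts with the correct answer on each of these inputs (and may do anything on other inputs). -/
def DecidableOn {α : Type} [Primcodable α] (dom p : α → Prop) : Prop :=
  ∃ f : α →. Bool, Partrec f ∧ ∀ a, dom a → ∃ b ∈ f a, (b = true ↔ p a)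

end ExRules

/-! The proof reduces from halting. Rules without existential variables can define addition,
multiplication, pairing and the graph of any partial recursive function, once an infinite successor
chain is available; the only difficulty is to create that chain within msa+trans.

This is done by `extendRule`. It extends a successor pair (x, y) only if t(y, x) holds, and it links
the new element z to y by a t-path of length two, through a second new element. With t transitive,
t(z, y) follows, the rule applies again, and every model contains an infinite chain
(`exists_chain`). Without transitivity the path is never closed, so the rule does not fire on its
own output, and a three-element model shows that the remaining rules are msa (`isMSA_baseRules`).

For a code `c` with undecidable domain, the rules are fixed and only the facts and the query depend
on the input n, which is named by a constant at the end of a finite chain. If the query is entailed,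
it holds in the standard model on ℕ, so `eval c n` is defined (`dom_of_entailed`). Conversely, a
computation of `eval c n` can be replayed along the chain of an arbitrary model (`IsChain.eval`,
`entailed_of_dom`). -/

namespace ExRules

open Nat.Partrec (Code)
open Nat.Partrec.Code (eval)
open Encodable (encode)
open Denumerable (ofNat)

/-! ### Rules without existential variables -/

section Semantics

variable {P K D : Type} (I : Interp P K D)

/-- The atom whose predicate is `p` and whose arguments are the variables `xs`. -/
def varAtom (p : P) (xs : List ℕ) : Atom P K := (p, xs.map Sum.inr)

@[simp]
theorem varAtom_fst (p : P) (xs : List ℕ) : (varAtom p xs : Atom P K).1 = p := rfl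

@[simp]
theorem inr_mem_varAtom (p : P) (xs : List ℕ) (x : ℕ) :
    (Sum.inr x : Term K) ∈ (varAtom p xs : Atom P K).2 ↔ x ∈ xs := by
  simp [varAtom]

@[simp]
theorem Interp.satAtom_varAtom (v : ℕ → D) (p : P) (xs : List ℕ) :
    I.SatAtom v (varAtom p xs) ↔ I.rel p (xs.map v) := by
  simp [Interp.SatAtom, varAtom, Function.comp_def, Interp.val]

@[simp]
theorem Interp.satConj_nil (v : ℕ → D) : I.SatConj v [] := by
  simp [Interp.SatConj]

@[simp]
theorem Interp.satConj_cons (v : ℕ → D) (a : Atom P K) (A : List (Atom P K)) :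
    I.SatConj v (a :: A) ↔ I.SatAtom v a ∧ I.SatConj v A := by
  simp [Interp.SatConj]

@[simp]
theorem not_varIn_nil (x : ℕ) : ¬ VarIn x ([] : List (Atom P K)) := by
  simp [VarIn]

@[simp]
theorem varIn_cons (x : ℕ) (a : Atom P K) (A : List (Atom P K)) :
    VarIn x (a :: A) ↔ Sum.inr x ∈ a.2 ∨ VarIn x A := by
  simp [VarIn]

/-- The truth of a conjunction depends only on the values of the variables that occur in it. -/
theorem Interp.satConj_congr {v w : ℕ → D} {A : List (Atom P K)}
    (h : ∀ x, VarIn x A → w x = v x) : I.SatConj w A ↔ I.SatConj v A := by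
  refine forall₂_congr fun a ha => ?_
  have : a.2.map (I.val w) = a.2.map (I.val v) := by
    refine List.map_congr_left fun t ht => ?_
    cases t with
    | inl c => rfl
    | inr x => exact h x ⟨a, ha, ht⟩
  simp [Interp.SatAtom, this]

/-- A rule all of whose head variables occur in the body. -/
def IsDatalog (r : Rule P K) : Prop := ∀ x, VarIn x r.2 → VarIn x r.1

theorem Interp.satRule_iff {r : Rule P K} (hr : IsDatalog r) :
    I.SatRule r ↔ ∀ v, I.SatConj v r.1 → I.SatConj v r.2 := by
  refine forall₂_congr fun v _ => ⟨?_, fun h => ⟨v, fun _ _ => rfl, h⟩⟩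
  rintro ⟨w, hw, h⟩
  exact (I.satConj_congr fun x hx => hw x (hr x hx)).1 h

end Semantics

/-! ### The rule sets -/

/-- The predicate `y = x + 1`. -/
abbrev nextP : ℕ := 0
/-- The transitive predicate. -/
abbrev transP : ℕ := 1
/-- The predicate `x = 0`. -/
abbrev zeroP : ℕ := 2
/-- The predicate `z = x + y`. -/
abbrev addP : ℕ := 3
/-- The predicate `z = x * y`. -/
abbrev mulP : ℕ := 4
/-- The predicate `z = Nat.pair x y`. -/
abbrev pairP : ℕ := 5
/-- The predicate `y ∈ eval c x`. -/
abbrev evalP (c : Code) : ℕ := encode c + 6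

/-- `next(x, y) ∧ t(y, x) → ∃ z u, next(y, z) ∧ t(z, u) ∧ t(u, y)`. Only a transitive `t` makes the
rule applicable to the new pair `(y, z)`. -/
def extendRule : Rule ℕ ℕ :=
  ([varAtom nextP [0, 1], varAtom transP [1, 0]],
    [varAtom nextP [1, 2], varAtom transP [2, 3], varAtom transP [3, 1]])

/-- Transitivity of `transP`. -/
def transRule : Rule ℕ ℕ :=
  ([varAtom transP [0, 1], varAtom transP [1, 2]], [varAtom transP [0, 2]])

/-- The rules that define addition, multiplication and pairing. -/
def arithRules : List (Rule ℕ ℕ) :=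
  -- The `nextP` atom only places variable 0 in the body, so that it is not existential.
  [([varAtom nextP [0, 1], varAtom zeroP [2]], [varAtom addP [0, 2, 0]]),
    ([varAtom addP [0, 1, 2], varAtom nextP [1, 3], varAtom nextP [2, 4]],
      [varAtom addP [0, 3, 4]]),
    ([varAtom nextP [0, 1], varAtom zeroP [2]], [varAtom mulP [0, 2, 2]]),
    ([varAtom mulP [0, 1, 2], varAtom nextP [1, 3], varAtom addP [2, 0, 4]],
      [varAtom mulP [0, 3, 4]]),
    -- The two cases of `Nat.pair a b`. Here a < b is expressed by b = a + s with s a successor, and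
    -- the value is b * b + a; the next rule expresses b ≤ a by a = b + k, with value a * a + a + b.
    ([varAtom nextP [0, 1], varAtom addP [2, 1, 3], varAtom mulP [3, 3, 4],
      varAtom addP [4, 2, 5]], [varAtom pairP [2, 3, 5]]),
    ([varAtom addP [0, 1, 2], varAtom mulP [2, 2, 3], varAtom addP [3, 2, 4],
      varAtom addP [4, 0, 5]], [varAtom pairP [2, 0, 5]])]

/-- The rules that evaluate a code. -/
def codeRules : Code → List (Rule ℕ ℕ)
  | .zero => [([varAtom nextP [0, 1], varAtom zeroP [2]], [varAtom (evalP .zero) [0, 2]])]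
  | .succ => [([varAtom nextP [0, 1]], [varAtom (evalP .succ) [0, 1]])]
  | .left => [([varAtom pairP [0, 1, 2]], [varAtom (evalP .left) [2, 0]])]
  | .right => [([varAtom pairP [0, 1, 2]], [varAtom (evalP .right) [2, 1]])]
  | .pair f g =>
    ([varAtom (evalP f) [0, 1], varAtom (evalP g) [0, 2], varAtom pairP [1, 2, 3]],
      [varAtom (evalP (.pair f g)) [0, 3]]) :: (codeRules f ++ codeRules g)
  | .comp f g =>
    ([varAtom (evalP g) [0, 1], varAtom (evalP f) [1, 2]],
      [varAtom (evalP (.comp f g)) [0, 2]]) :: (codeRules f ++ codeRules g)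
  | .prec f g =>
    ([varAtom zeroP [0], varAtom pairP [1, 0, 2], varAtom (evalP f) [1, 3]],
      [varAtom (evalP (.prec f g)) [2, 3]]) ::
    ([varAtom pairP [0, 1, 2], varAtom (evalP (.prec f g)) [2, 3], varAtom pairP [1, 3, 4],
      varAtom pairP [0, 4, 5], varAtom (evalP g) [5, 6], varAtom nextP [1, 7],
      varAtom pairP [0, 7, 8]], [varAtom (evalP (.prec f g)) [8, 6]]) ::
    (codeRules f ++ codeRules g)
  | .rfind' f =>
    ([varAtom pairP [0, 1, 2], varAtom (evalP f) [2, 3], varAtom zeroP [3]],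
      [varAtom (evalP (.rfind' f)) [2, 1]]) ::
    ([varAtom pairP [0, 1, 2], varAtom (evalP f) [2, 3], varAtom nextP [4, 3],
      varAtom nextP [1, 5], varAtom pairP [0, 5, 6], varAtom (evalP (.rfind' f)) [6, 7]],
      [varAtom (evalP (.rfind' f)) [2, 7]]) ::
    codeRules f

/-- A rule with non-empty body and head and without existential variables, whose head predicates
are neither `nextP` nor `transP`. -/
def IsDerived (r : Rule ℕ ℕ) : Prop :=
  r.1 ≠ [] ∧ r.2 ≠ [] ∧ IsDatalog r ∧ ∀ a ∈ r.2, 2 ≤ a.1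

theorem isDerived_of_mem_arithRules : ∀ r ∈ arithRules, IsDerived r := by
  simp only [arithRules, List.forall_mem_cons]
  simp [IsDerived, IsDatalog, addP, mulP, pairP]

theorem isDerived_of_mem_codeRules (c : Code) : ∀ r ∈ codeRules c, IsDerived r := by
  induction c <;>
    simp only [codeRules, List.forall_mem_cons, List.forall_mem_append] <;>
    and_intros <;> first | assumption | simp [IsDerived, IsDatalog]

/-- The rules of the knowledge base, except transitivity. -/
def baseRules (c : Code) : List (Rule ℕ ℕ) := extendRule :: (arithRules ++ codeRules c)

theorem isDerived_of_mem_baseRules {c : Code} {r : Rule ℕ ℕ} (hr : r ∈ baseRules c) :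
    r = extendRule ∨ IsDerived r := by
  simp only [baseRules, List.mem_cons, List.mem_append] at hr
  rcases hr with h | h | h
  exacts [.inl h, .inr (isDerived_of_mem_arithRules r h), .inr (isDerived_of_mem_codeRules c r h)]

/-! ### Acyclicity -/

/-- A finite model of the summarizing program of `baseRules`: `0` stands for `∗`, and `1` and `2`
for the two constants of `extendRule`. -/
def summaryModel : Interp (MSAPred ℕ ℕ) (MSAConst ℕ ℕ) (Fin 3) where
  const
    | .orig _ => 0
    | .star => 0
    | .sk _ y => if y = 2 then 1 else 2
  rel
    -- The all-zero tuples come from the critical instance; the others are what one application of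
    -- `extendRule` at ∗ adds. All other original predicates can be full, because no rule derives
    -- `nextP` or `transP` from them.
    | .orig 0, l => (∀ d ∈ l, d = 0) ∨ l = [0, 1]
    | .orig 1, l => (∀ d ∈ l, d = 0) ∨ l = [1, 2] ∨ l = [2, 0]
    | .orig _, _ => True
    | .F _ _, l => ∀ d ∈ l, d ≠ 0
    | .S, l => l.head? = some 0
    | .D, l => l.head? = some 0
    | .C, _ => False

/-- The only other successor pair is (0, 1), and it would need t(1, 0). That atom is the composition
of t(1, 2) and t(2, 0), which is absent exactly because transitivity is not imposed. -/
theorem summaryModel_satConj_extendRule {v : ℕ → Fin 3}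
    (h : summaryModel.SatConj v (msaBody extendRule)) : v 0 = 0 ∧ v 1 = 0 := by
  simp only [msaBody, extendRule, varAtom, liftTerm, Interp.satConj_cons, Interp.SatAtom,
    summaryModel, Interp.val, List.map] at h
  revert h
  generalize v 0 = a
  generalize v 1 = b
  revert a b
  simp
  decide

theorem summaryModel_satRule {c : Code} {ρ : Rule (MSAPred ℕ ℕ) (MSAConst ℕ ℕ)}
    (hρ : MSAProgram {r | r ∈ baseRules c} ρ) : summaryModel.SatRule ρ := by
  have not_ex : ∀ {r y}, r ∈ baseRules c → IsExistential r y → r = extendRule := by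
    intro r y hr hy
    rcases isDerived_of_mem_baseRules hr with h | h
    exacts [h, (hy.1 (h.2.2.1 y hy.2)).elim]
  intro v hv
  -- Existential variables have become constants, so the given assignment already serves for the
  -- head.
  refine ⟨v, fun _ _ => rfl, ?_⟩
  cases hρ with
  | main r hr =>
    rcases isDerived_of_mem_baseRules hr with rfl | h
    · obtain ⟨h0, h1⟩ := summaryModel_satConj_extendRule hv
      simp [msaMain, extendRule, varAtom, skTerm, Interp.SatAtom, summaryModel, Interp.val, h1]
    · intro a ha
      obtain ⟨b, hb, rfl⟩ := List.mem_map.1 ha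
      obtain ⟨k, hk⟩ := Nat.exists_eq_add_of_le' (h.2.2.2 b hb)
      simp [Interp.SatAtom, summaryModel, hk]
  | mark r hr y hy =>
    have : summaryModel.const (MSAConst.sk r y) ≠ 0 := by
      by_cases h : y = 2 <;> simp [summaryModel, h]
    have : summaryModel.rel (.F r y) [summaryModel.const (MSAConst.sk r y)] :=
      List.forall_mem_singleton.2 this
    simpa [Interp.SatAtom, Interp.val] using this
  | succ r hr y hy x hx =>
    obtain rfl := not_ex hr hy
    obtain ⟨h0, h1⟩ := summaryModel_satConj_extendRule hv
    obtain rfl : x = 1 := by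
      obtain ⟨hx, hx'⟩ := hx
      simp [extendRule] at hx hx'
      omega
    simp [Interp.SatAtom, summaryModel, Interp.val, h1]
  | base => simpa [Interp.SatAtom, summaryModel, Interp.val] using hv
  | step =>
    simp only [Interp.satConj_cons] at hv
    simpa [Interp.SatAtom, summaryModel, Interp.val] using hv.1
  | cycle r hr y hy =>
    -- `F` excludes 0, whereas `D` requires its first argument to be 0.
    simp [Interp.SatAtom, summaryModel, Interp.val] at hv
    exact (hv.1 hv.2.1).elim

theorem isMSA_baseRules (c : Code) : IsMSA {r | r ∈ baseRules c} := by
  intro h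
  have hC : ¬ summaryModel.SatCQ [(MSAPred.C, [])] := fun ⟨v, hv⟩ => by
    simp [Interp.SatAtom, summaryModel] at hv
  refine hC (h (Fin 3) summaryModel ?_ fun ρ hρ => summaryModel_satRule hρ)
  · rintro ⟨p, l⟩ ⟨r, -, b, -, hp, -, hl⟩
    obtain rfl : p = MSAPred.orig b.1 := hp
    refine ⟨fun _ => 0, ?_⟩
    have h0 : ∀ d ∈ l.map (summaryModel.val fun _ => 0), d = 0 := by
      simp only [List.mem_map, forall_exists_index, and_imp, forall_apply_eq_imp_iff₂]
      intro t ht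
      obtain ⟨c, hc, rfl⟩ := hl t ht
      cases hc <;> rfl
    simp only [Interp.satConj_cons, Interp.satConj_nil, and_true, Interp.SatAtom]
    change summaryModel.rel _ (l.map _)
    generalize b.1 = k
    match k with
    | 0 => exact .inl h0
    | 1 => exact .inl h0
    | k + 2 => trivial

/-! ### Soundness -/

/-- The search starts at m and returns the absolute position of the zero, hence the offset n + m.
The two lemmas below unfold one step of it, matching the two rules for `rfind'`. -/
theorem mem_eval_rfind' {f : Code} {a m y : ℕ} :
    y ∈ eval (.rfind' f) (Nat.pair a m) ↔
      ∃ n, (0 ∈ eval f (Nat.pair a (n + m)) ∧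
        ∀ i < n, ∃ k, k + 1 ∈ eval f (Nat.pair a (i + m))) ∧ n + m = y := by
  simp only [eval, Nat.unpaired, Nat.unpair_pair]
  refine (Part.mem_map_iff _).trans (exists_congr fun n => and_congr_left fun _ => ?_)
  refine Nat.mem_rfind.trans (and_congr ?_ (forall₂_congr fun i _ => ?_))
  · refine (Part.mem_map_iff _).trans ⟨?_, fun h => ⟨0, h, rfl⟩⟩
    rintro ⟨z, hz, hz0⟩
    rwa [of_decide_eq_true hz0] at hz
  · refine (Part.mem_map_iff _).trans ⟨?_, fun ⟨k, hk⟩ => ⟨k + 1, hk, rfl⟩⟩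
    rintro ⟨z, hz, hz0⟩
    obtain ⟨k, rfl⟩ := Nat.exists_eq_succ_of_ne_zero (of_decide_eq_false hz0)
    exact ⟨k, hz⟩

theorem mem_eval_rfind'_of_zero_mem {f : Code} {a m : ℕ} (h : 0 ∈ eval f (Nat.pair a m)) :
    m ∈ eval (.rfind' f) (Nat.pair a m) :=
  mem_eval_rfind'.2 ⟨0, ⟨by simpa using h, by simp⟩, by simp⟩

theorem mem_eval_rfind'_of_succ_mem {f : Code} {a m k y : ℕ}
    (h : k + 1 ∈ eval f (Nat.pair a m))
    (hy : y ∈ eval (.rfind' f) (Nat.pair a (m + 1))) :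
    y ∈ eval (.rfind' f) (Nat.pair a m) := by
  obtain ⟨n, ⟨h0, hlt⟩, rfl⟩ := mem_eval_rfind'.1 hy
  have e : ∀ i, i + 1 + m = i + (m + 1) := fun i => by omega
  refine mem_eval_rfind'.2 ⟨n + 1, ⟨by rwa [e], fun i hi => ?_⟩, e n⟩
  cases i with
  | zero => exact ⟨k, by simpa using h⟩
  | succ i =>
    rw [e]
    exact hlt i (by omega)

/-- The intended model, on the natural numbers. -/
def natModel : Interp ℕ ℕ ℕ where
  const := id
  rel
    | 0, [x, y] => y = x + 1
    -- The predicate t only controls when `extendRule` fires, so soundness allows it to be full.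
    | 1, _ => True
    | 2, [x] => x = 0
    | 3, [x, y, z] => z = x + y
    | 4, [x, y, z] => z = x * y
    | 5, [x, y, z] => z = Nat.pair x y
    | k + 6, [x, y] => y ∈ eval (ofNat Code k) x
    | _, _ => False

section natModel

variable (x y z : ℕ) (l : List ℕ)

@[simp] theorem natModel_next : natModel.rel nextP [x, y] ↔ y = x + 1 := Iff.rfl
@[simp] theorem natModel_trans : natModel.rel transP l ↔ True := by cases l <;> rfl
@[simp] theorem natModel_zero : natModel.rel zeroP [x] ↔ x = 0 := Iff.rfl
@[simp] theorem natModel_add : natModel.rel addP [x, y, z] ↔ z = x + y := Iff.rfl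
@[simp] theorem natModel_mul : natModel.rel mulP [x, y, z] ↔ z = x * y := Iff.rfl
@[simp] theorem natModel_pair : natModel.rel pairP [x, y, z] ↔ z = Nat.pair x y := Iff.rfl
@[simp] theorem natModel_eval (c : Code) : natModel.rel (evalP c) [x, y] ↔ y ∈ eval c x := by
  change y ∈ eval (ofNat Code (encode c)) x ↔ _
  rw [Denumerable.ofNat_encode]

end natModel

theorem natModel_arithRules : ∀ r ∈ arithRules, natModel.SatRule r := by
  intro r hr
  rw [natModel.satRule_iff (isDerived_of_mem_arithRules r hr).2.2.1]
  revert r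
  simp only [arithRules, List.forall_mem_cons, Interp.satConj_cons, Interp.satConj_nil,
    Interp.satAtom_varAtom, List.map, natModel_next, natModel_zero, natModel_add, natModel_mul,
    natModel_pair, and_true, and_imp]
  refine ⟨?_, ?_, ?_, ?_, ?_, ?_, by simp⟩ <;> intro v
  · intros; omega
  · intros; omega
  · intro _ h; simp [h]
  · intro h1 h2 h3; rw [h3, h1, h2]; ring
  · intro h1 h2 h3 h4; rw [h4, h3, Nat.pair, if_pos (by omega)]
  · intro h1 h2 h3 h4; rw [h4, h3, h2, Nat.pair, if_neg (by omega)]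

theorem natModel_codeRules (c : Code) : ∀ r ∈ codeRules c, natModel.SatRule r := by
  have key : ∀ {r : Rule ℕ ℕ} {c}, r ∈ codeRules c →
      (∀ v, natModel.SatConj v r.1 → natModel.SatConj v r.2) → natModel.SatRule r :=
    fun hr h => (natModel.satRule_iff (isDerived_of_mem_codeRules _ _ hr).2.2.1).2 h
  induction c with
  | zero =>
    intro r hr
    refine key hr ?_
    obtain rfl := List.mem_singleton.1 hr
    simp [eval, pure, PFun.pure]
  | succ =>
    intro r hr
    refine key hr ?_
    obtain rfl := List.mem_singleton.1 hr
    simp [eval]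
  | left =>
    intro r hr
    refine key hr ?_
    obtain rfl := List.mem_singleton.1 hr
    intro v
    simp +contextual [eval]
  | right =>
    intro r hr
    refine key hr ?_
    obtain rfl := List.mem_singleton.1 hr
    intro v
    simp +contextual [eval]
  | pair f g hf hg =>
    refine List.forall_mem_cons.2 ⟨key (c := .pair f g) List.mem_cons_self ?_,
      List.forall_mem_append.2 ⟨hf, hg⟩⟩
    simp only [Interp.satConj_cons, Interp.satAtom_varAtom, List.map, natModel_eval,
      natModel_pair, and_imp, Interp.satConj_nil, and_true]
    rintro v h1 h2 h3
    simp only [eval, Seq.seq, Part.map_eq_map, Part.mem_bind_iff,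
      Part.mem_map_iff]
    exact ⟨_, ⟨_, h1, rfl⟩, _, h2, h3.symm⟩
  | comp f g hf hg =>
    refine List.forall_mem_cons.2 ⟨key (c := .comp f g) List.mem_cons_self ?_,
      List.forall_mem_append.2 ⟨hf, hg⟩⟩
    simp only [Interp.satConj_cons, Interp.satAtom_varAtom, List.map, natModel_eval,
      and_imp, Interp.satConj_nil, and_true]
    rintro v h1 h2
    exact Part.mem_bind h1 h2
  | prec f g hf hg =>
    refine List.forall_mem_cons.2 ⟨key (c := .prec f g) List.mem_cons_self ?_,
      List.forall_mem_cons.2 ⟨key (c := .prec f g) (List.mem_cons_of_mem _ List.mem_cons_self) ?_,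
      List.forall_mem_append.2 ⟨hf, hg⟩⟩⟩
    · simp only [Interp.satConj_cons, Interp.satAtom_varAtom, List.map, natModel_eval,
        natModel_pair, natModel_zero, and_imp, Interp.satConj_nil, and_true]
      intro v h1 h2 h3
      rwa [h2, h1, Nat.Partrec.Code.eval_prec_zero]
    · simp only [Interp.satConj_cons, Interp.satAtom_varAtom, List.map, natModel_eval,
        natModel_pair, natModel_next, and_imp, Interp.satConj_nil, and_true]
      intro v h1 h2 h3 h4 h5 h6 h7
      rw [h7, h6, Nat.Partrec.Code.eval_prec_succ]
      rw [h1] at h2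
      rw [h4, h3] at h5
      exact Part.mem_bind h2 h5
  | rfind' f hf =>
    refine List.forall_mem_cons.2 ⟨key (c := .rfind' f) List.mem_cons_self ?_,
      List.forall_mem_cons.2 ⟨key (c := .rfind' f) (List.mem_cons_of_mem _ List.mem_cons_self) ?_,
      hf⟩⟩
    · simp only [Interp.satConj_cons, Interp.satAtom_varAtom, List.map, natModel_eval,
        natModel_pair, natModel_zero, and_imp, Interp.satConj_nil, and_true]
      intro v h1 h2 h3
      rw [h1, h3] at h2
      rw [h1]
      exact mem_eval_rfind'_of_zero_mem h2
    · simp only [Interp.satConj_cons, Interp.satAtom_varAtom, List.map, natModel_eval,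
        natModel_pair, natModel_next, and_imp, Interp.satConj_nil, and_true]
      intro v h1 h2 h3 h4 h5 h6
      rw [h1, h3] at h2
      rw [h5, h4] at h6
      rw [h1]
      exact mem_eval_rfind'_of_succ_mem h2 h6

theorem natModel_extendRule : natModel.SatRule extendRule := by
  intro v hv
  -- Only the new successor, variable 2, matters; variable 3 occurs only in t-atoms and may be
  -- anything.
  refine ⟨fun x => if x = 2 then v 1 + 1 else v x, fun x hx => if_neg ?_, by simp [extendRule]⟩
  rintro rfl
  simp [extendRule] at hx

/-! ### Completeness -/

section Chain

variable {D : Type} {I : Interp ℕ ℕ D} {d : ℕ → D}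

/-- A rule without existential variables that holds in `I`, applied to elements of a chain. -/
theorem Interp.apply_rule {r : Rule ℕ ℕ} (h : I.SatRule r) (hr : IsDatalog r) (d : ℕ → D)
    (xs : List ℕ) (hb : I.SatConj (fun k => d (xs.getD k 0)) r.1) :
    I.SatConj (fun k => d (xs.getD k 0)) r.2 :=
  (I.satRule_iff hr).1 h _ hb

/-- `d` interprets the natural numbers in `I`, as far as `nextP` and `zeroP` are concerned. -/
structure IsChain (I : Interp ℕ ℕ D) (d : ℕ → D) : Prop where
  next (i : ℕ) : I.rel nextP [d i, d (i + 1)]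
  zero : I.rel zeroP [d 0]

/-- Addition and multiplication are derived by induction on the second argument. The chain need not
be injective, since only positive facts are derived. -/
theorem IsChain.pair (hd : IsChain I d) (h : ∀ r ∈ arithRules, I.SatRule r) :
    ∀ x y, I.rel pairP [d x, d y, d (Nat.pair x y)] := by
  -- An assignment into the chain is coded by the list of indices for variables 0, 1, …; the default
  -- 0 only concerns variables that the rule does not use.
  have key : ∀ r ∈ arithRules, ∀ xs : List ℕ, I.SatConj (fun k => d (xs.getD k 0)) r.1 →
      I.SatConj (fun k => d (xs.getD k 0)) r.2 := fun r hr =>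
    Interp.apply_rule (h r hr) (isDerived_of_mem_arithRules r hr).2.2.1 d
  simp only [arithRules, List.forall_mem_cons, Interp.satConj_cons, Interp.satConj_nil,
    Interp.satAtom_varAtom, List.map, and_true, and_imp] at key
  obtain ⟨a0, a1, m0, m1, p0, p1, -⟩ := key
  have hadd : ∀ x y, I.rel addP [d x, d y, d (x + y)] := by
    intro x y
    induction y with
    | zero => exact a0 [x, x + 1, 0] (hd.next x) hd.zero
    | succ y ih => exact a1 [x, y, x + y, y + 1, x + y + 1] ih (hd.next y) (hd.next _)
  have hmul : ∀ x y, I.rel mulP [d x, d y, d (x * y)] := by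
    intro x y
    induction y with
    | zero => exact m0 [x, x + 1, 0] (hd.next x) hd.zero
    | succ y ih => exact m1 [x, y, x * y, y + 1, x * y + x] ih (hd.next y) (hadd _ _)
  intro x y
  rw [Nat.pair]
  split_ifs with hxy
  · obtain ⟨k, rfl⟩ := Nat.exists_eq_add_of_lt hxy
    exact p0 [k, k + 1, x, x + k + 1, (x + k + 1) * (x + k + 1),
      (x + k + 1) * (x + k + 1) + x] (hd.next k) (hadd x (k + 1)) (hmul _ _) (hadd _ _)
  · obtain ⟨k, rfl⟩ := Nat.exists_eq_add_of_le (not_lt.1 hxy)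
    exact p1 [y, k, y + k, (y + k) * (y + k), (y + k) * (y + k) + (y + k),
      (y + k) * (y + k) + (y + k) + y] (hadd _ _) (hmul _ _) (hadd _ _) (hadd _ _)

/-- Induction on the code: each rule mirrors one clause of `eval`, with an inner induction for
primitive recursion and for search. -/
theorem IsChain.eval (hd : IsChain I d) (pair : ∀ x y, I.rel pairP [d x, d y, d (Nat.pair x y)])
    (c : Code) (h : ∀ r ∈ codeRules c, I.SatRule r) :
    ∀ x y, y ∈ eval c x → I.rel (evalP c) [d x, d y] := by
  have key : ∀ r ∈ codeRules c, ∀ xs : List ℕ, I.SatConj (fun k => d (xs.getD k 0)) r.1 →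
      I.SatConj (fun k => d (xs.getD k 0)) r.2 := fun r hr =>
    Interp.apply_rule (h r hr) (isDerived_of_mem_codeRules c r hr).2.2.1 d
  induction c with
  | zero =>
    intro x y hy
    obtain rfl : y = 0 := by simpa [Nat.Partrec.Code.eval, Pure.pure, PFun.pure] using hy
    simp only [codeRules, List.forall_mem_cons, Interp.satConj_cons, Interp.satConj_nil,
      Interp.satAtom_varAtom, List.map, and_true, and_imp] at key
    exact key.1 [x, x + 1, 0] (hd.next x) hd.zero
  | succ =>
    intro x y hy
    obtain rfl : y = x + 1 := by simpa [Nat.Partrec.Code.eval] using hy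
    simp only [codeRules, List.forall_mem_cons, Interp.satConj_cons, Interp.satConj_nil,
      Interp.satAtom_varAtom, List.map, and_true] at key
    exact key.1 [x, x + 1] (hd.next x)
  | left =>
    intro x y hy
    obtain rfl : y = x.unpair.1 := by simpa [Nat.Partrec.Code.eval] using hy
    simp only [codeRules, List.forall_mem_cons, Interp.satConj_cons, Interp.satConj_nil,
      Interp.satAtom_varAtom, List.map, and_true] at key
    have := key.1 [x.unpair.1, x.unpair.2, Nat.pair x.unpair.1 x.unpair.2] (pair _ _)
    rwa [Nat.pair_unpair] at this
  | right =>
    intro x y hy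
    obtain rfl : y = x.unpair.2 := by simpa [Nat.Partrec.Code.eval] using hy
    simp only [codeRules, List.forall_mem_cons, Interp.satConj_cons, Interp.satConj_nil,
      Interp.satAtom_varAtom, List.map, and_true] at key
    have := key.1 [x.unpair.1, x.unpair.2, Nat.pair x.unpair.1 x.unpair.2] (pair _ _)
    rwa [Nat.pair_unpair] at this
  | pair f g hf hg =>
    simp only [codeRules, List.forall_mem_cons, List.forall_mem_append] at h key
    obtain ⟨k1, kf, kg⟩ := key
    intro x y hy
    simp only [Nat.Partrec.Code.eval, Seq.seq, Part.map_eq_map,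
      Part.mem_bind_iff, Part.mem_map_iff] at hy
    obtain ⟨_, ⟨a, ha, rfl⟩, b, hb, rfl⟩ := hy
    simp only [Interp.satConj_cons, Interp.satConj_nil, Interp.satAtom_varAtom, List.map,
      and_true, and_imp] at k1
    exact k1 [x, a, b, Nat.pair a b] (hf h.2.1 kf _ _ ha) (hg h.2.2 kg _ _ hb) (pair a b)
  | comp f g hf hg =>
    simp only [codeRules, List.forall_mem_cons, List.forall_mem_append] at h key
    obtain ⟨k1, kf, kg⟩ := key
    intro x y hy
    obtain ⟨a, ha, hb⟩ := Part.mem_bind_iff.1 hy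
    simp only [Interp.satConj_cons, Interp.satConj_nil, Interp.satAtom_varAtom, List.map,
      and_true, and_imp] at k1
    exact k1 [x, a, y] (hg h.2.2 kg _ _ ha) (hf h.2.1 kf _ _ hb)
  | prec f g hf hg =>
    simp only [codeRules, List.forall_mem_cons, List.forall_mem_append] at h key
    obtain ⟨k1, k2, kf, kg⟩ := key
    simp only [Interp.satConj_cons, Interp.satConj_nil, Interp.satAtom_varAtom, List.map,
      and_true, and_imp] at k1 k2
    suffices H : ∀ a n y, y ∈ Nat.Partrec.Code.eval (.prec f g) (Nat.pair a n) →
        I.rel (evalP (.prec f g)) [d (Nat.pair a n), d y] by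
      intro x y hy
      rw [← Nat.pair_unpair x] at hy ⊢
      exact H _ _ _ hy
    intro a n
    induction n with
    | zero =>
      intro y hy
      rw [Nat.Partrec.Code.eval_prec_zero] at hy
      exact k1 [0, a, Nat.pair a 0, y] hd.zero (pair a 0) (hf h.2.2.1 kf _ _ hy)
    | succ n ih =>
      intro y hy
      rw [Nat.Partrec.Code.eval_prec_succ] at hy
      obtain ⟨i, hi, hy⟩ := Part.mem_bind_iff.1 hy
      exact k2 [a, n, Nat.pair a n, i, Nat.pair n i, Nat.pair a (Nat.pair n i), y, n + 1,
        Nat.pair a (n + 1)] (pair _ _) (ih i hi) (pair _ _) (pair _ _)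
        (hg h.2.2.2 kg _ _ hy) (hd.next n) (pair _ _)
  | rfind' f hf =>
    simp only [codeRules, List.forall_mem_cons] at h key
    obtain ⟨k1, k2, kf⟩ := key
    simp only [Interp.satConj_cons, Interp.satConj_nil, Interp.satAtom_varAtom, List.map,
      and_true, and_imp] at k1 k2
    have hf := hf h.2.2 kf
    -- Induction on the number n of failed tests. The start m stays general, because a failed test
    -- moves the search to m + 1.
    suffices H : ∀ a n m, 0 ∈ Nat.Partrec.Code.eval f (Nat.pair a (n + m)) →
        (∀ i < n, ∃ k, k + 1 ∈ Nat.Partrec.Code.eval f (Nat.pair a (i + m))) →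
        I.rel (evalP (.rfind' f)) [d (Nat.pair a m), d (n + m)] by
      intro x y hy
      rw [← Nat.pair_unpair x] at hy ⊢
      obtain ⟨n, ⟨h0, hlt⟩, rfl⟩ := mem_eval_rfind'.1 hy
      exact H _ _ _ h0 hlt
    intro a n
    induction n with
    | zero =>
      intro m h0 _
      rw [Nat.zero_add] at h0 ⊢
      exact k1 [a, m, Nat.pair a m, 0] (pair _ _) (hf _ _ h0) hd.zero
    | succ n ih =>
      intro m h0 hlt
      obtain ⟨k, hk⟩ := hlt 0 (by omega)
      rw [Nat.zero_add] at hk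
      have e : ∀ i, i + 1 + m = i + (m + 1) := fun i => by omega
      rw [e] at h0 ⊢
      exact k2 [a, m, Nat.pair a m, k + 1, k, m + 1, Nat.pair a (m + 1), n + (m + 1)] (pair _ _)
        (hf _ _ hk) (hd.next k) (hd.next m) (pair _ _)
        (ih (m + 1) h0 fun i hi => by rw [← e]; exact hlt (i + 1) (by omega))

end Chain

/-! ### The reduction -/

/-- The fact whose predicate is `p` and whose arguments are the constants `cs`. -/
def constAtom (p : ℕ) (cs : List ℕ) : Atom ℕ ℕ := (p, cs.map Sum.inl)

/-- The facts that describe an initial segment of a chain, up to `n + 1`. -/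
def chainFacts (n : ℕ) : List (Atom ℕ ℕ) :=
  constAtom zeroP [0] ::
    ((List.range (n + 1)).map (fun i => constAtom nextP [i, i + 1]) ++
      (List.range (n + 1)).map fun i => constAtom transP [i + 1, i])

/-- The instance that asks whether `eval c n` is defined. -/
def evalInstance (c : Code) (n : ℕ) : Instance :=
  (chainFacts n, transRule :: baseRules c, (evalP c, [Sum.inl n, Sum.inr 0]))

@[simp]
theorem Interp.satCQ_constAtom {D : Type} [Nonempty D] (I : Interp ℕ ℕ D) (p : ℕ) (cs : List ℕ) :
    I.SatCQ [constAtom p cs] ↔ I.rel p (cs.map I.const) := by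
  simp [Interp.SatCQ, Interp.SatAtom, constAtom, Function.comp_def, Interp.val]

theorem overMSAPlusTrans_evalInstance (c : Code) (n : ℕ) :
    (evalInstance c n).OverMSAPlusTrans := by
  refine ⟨?_, ?_, {r | r ∈ baseRules c}, {transRule}, ?_, isMSA_baseRules c, ?_⟩
  · simp only [evalInstance, chainFacts, List.forall_mem_cons, List.forall_mem_append,
      List.forall_mem_map]
    simp [IsFact, constAtom]
  · refine List.forall_mem_cons.2 ⟨by simp [transRule], fun r hr => ?_⟩
    rcases isDerived_of_mem_baseRules hr with rfl | h
    exacts [by simp [extendRule], ⟨h.1, h.2.1⟩]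
  · ext r
    simp [evalInstance]
  · rintro r rfl
    exact ⟨transP, 0, 1, 2, by decide, by decide, by decide, rfl⟩

theorem dom_of_entailed {c : Code} {n : ℕ} (h : (evalInstance c n).Entailed) :
    (eval c n).Dom := by
  suffices hQ : natModel.SatCQ [(evalInstance c n).2.2] by
    obtain ⟨v, hv⟩ := hQ
    have : natModel.rel (evalP c) [n, v 0] := by
      rw [Interp.satConj_cons] at hv
      exact hv.1
    exact Part.dom_iff_mem.2 ⟨_, (natModel_eval _ _ c).1 this⟩
  refine h ℕ natModel ?_ ?_
  · change ∀ a ∈ chainFacts n, _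
    simp only [chainFacts, List.forall_mem_cons, List.forall_mem_append, List.forall_mem_map,
      Interp.satCQ_constAtom, List.map, natModel_next, natModel_trans, natModel_zero]
    simp [natModel]
  · simp only [evalInstance, Set.mem_ofPred_eq, baseRules, List.forall_mem_cons,
      List.forall_mem_append]
    refine ⟨?_, natModel_extendRule, natModel_arithRules, natModel_codeRules c⟩
    exact fun v _ => ⟨v, fun _ _ => rfl, by simp [transRule]⟩

/-- A model of `extendRule` and transitivity that contains an initial segment of a chain contains
a chain that prolongs it. -/
theorem exists_chain {D : Type} {I : Interp ℕ ℕ D} {n : ℕ} (e : ℕ → D)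
    (hnext : ∀ i ≤ n, I.rel nextP [e i, e (i + 1)])
    (htrans : ∀ i ≤ n, I.rel transP [e (i + 1), e i])
    (hextend : I.SatRule extendRule) (hr : I.SatRule transRule) :
    ∃ d : ℕ → D, (∀ i ≤ n, d i = e i) ∧ ∀ i, I.rel nextP [d i, d (i + 1)] := by
  -- The recursion runs over consecutive pairs and keeps the t-edge that allows `extendRule` to fire
  -- again; up to n it follows the given segment.
  let Q (i : ℕ) (q : D × D) : Prop :=
    I.rel nextP [q.1, q.2] ∧ I.rel transP [q.2, q.1] ∧ (i ≤ n → q = (e i, e (i + 1)))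
  have step : ∀ i (q : {q // Q i q}), ∃ q' : {q // Q (i + 1) q}, q'.1.1 = q.1.2 := by
    rintro i ⟨⟨x, y⟩, h1, h2, h3⟩
    by_cases hi : i + 1 ≤ n
    · refine ⟨⟨(e (i + 1), e (i + 2)), hnext _ hi, htrans _ hi, fun _ => rfl⟩, ?_⟩
      exact (congrArg Prod.snd (h3 (by omega))).symm
    · obtain ⟨w, hw, hh⟩ := hextend (fun k => if k = 0 then x else y)
        (by simpa [extendRule] using ⟨h1, h2⟩)
      have w1 : w 1 = y := by simpa using hw 1 (by simp [extendRule])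
      simp [extendRule, w1] at hh
      rw [I.satRule_iff (by simp [IsDatalog, transRule])] at hr
      -- Transitivity closes the path from `w 2` through `w 3` to `y`, which restores the invariant
      -- for the new pair.
      have ht := hr (fun k => if k = 0 then w 2 else if k = 1 then w 3 else y)
        (by simpa [transRule] using hh.2)
      exact ⟨⟨(y, w 2), hh.1, by simpa [transRule] using ht, fun h => (hi h).elim⟩, rfl⟩
  choose f hf using step
  let q : ∀ i, {q // Q i q} := fun i =>
    Nat.rec ⟨(e 0, e 1), hnext 0 (Nat.zero_le _), htrans 0 (Nat.zero_le _), fun _ => rfl⟩ f i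
  refine ⟨fun i => (q i).1.1, fun i hi => congrArg Prod.fst ((q i).2.2.2 hi), fun i => ?_⟩
  have : (q (i + 1)).1.1 = (q i).1.2 := hf i (q i)
  simpa only [this] using (q i).2.1

theorem entailed_of_dom {c : Code} {n : ℕ} (h : (eval c n).Dom) :
    (evalInstance c n).Entailed := by
  intro D I hF hR
  have : Nonempty D := ⟨I.const 0⟩
  change ∀ a ∈ chainFacts n, _ at hF
  simp only [chainFacts, List.forall_mem_cons, List.forall_mem_append, List.forall_mem_map,
    Interp.satCQ_constAtom, List.map, List.mem_range, Nat.lt_succ_iff] at hF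
  simp only [evalInstance, Set.mem_ofPred_eq, baseRules, List.forall_mem_cons,
    List.forall_mem_append] at hR
  obtain ⟨h0, hnext, htrans⟩ := hF
  obtain ⟨hr, hextend, harith, hcode⟩ := hR
  obtain ⟨d, hd, hdn⟩ := exists_chain I.const hnext htrans hextend hr
  have hc : IsChain I d := ⟨hdn, by rwa [hd 0 (Nat.zero_le _)]⟩
  obtain ⟨y, hy⟩ := Part.dom_iff_mem.1 h
  have := hc.eval (hc.pair harith) c hcode n y hy
  rw [hd n le_rfl] at this
  exact ⟨fun _ => d y, by simpa [evalInstance, Interp.SatAtom, Interp.val] using this⟩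

/-- As `c` is fixed, the rule list is a constant, and `codeRules` need not be shown computable. -/
theorem primrec_evalInstance (c : Code) : Primrec (evalInstance c) := by
  have inl : Primrec fun i : ℕ => (Sum.inl i : Term ℕ) := Primrec.sumInl
  have inl' : Primrec fun i : ℕ => (Sum.inl (i + 1) : Term ℕ) := Primrec.sumInl.comp Primrec.succ
  have nil : Primrec fun _ : ℕ => ([] : List (Term ℕ)) := Primrec.const _
  have range : Primrec fun n : ℕ => List.range (n + 1) := Primrec.list_range.comp Primrec.succ
  have next : Primrec fun i : ℕ => constAtom nextP [i, i + 1] :=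
    Primrec.pair (Primrec.const _)
      (Primrec.list_cons.comp inl (Primrec.list_cons.comp inl' nil))
  have trans : Primrec fun i : ℕ => constAtom transP [i + 1, i] :=
    Primrec.pair (Primrec.const _)
      (Primrec.list_cons.comp inl' (Primrec.list_cons.comp inl nil))
  have facts : Primrec chainFacts :=
    Primrec.list_cons.comp (Primrec.const _) (Primrec.list_append.comp
      (Primrec.list_map range (next.comp Primrec.snd).to₂)
      (Primrec.list_map range (trans.comp Primrec.snd).to₂))
  exact facts.pair ((Primrec.const _).pair ((Primrec.const _).pair
    (Primrec.list_cons.comp inl (Primrec.const _))))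

/-- There is a code whose domain is an undecidable set. -/
theorem exists_code_not_computablePred :
    ∃ c : Code, ¬ ComputablePred fun n => (eval c n).Dom := by
  -- The partial function that runs the n-th code on input 0; deciding its domain would decide
  -- halting on 0.
  have hu : Partrec fun n : ℕ => eval (ofNat Code n) 0 :=
    Nat.Partrec.Code.eval_part.comp (Computable.ofNat Code) (Computable.const 0)
  obtain ⟨c, hc⟩ := Nat.Partrec.Code.exists_code.1 (Partrec.nat_iff.1 hu)
  refine ⟨c, fun h => ComputablePred.halting_problem 0 ?_⟩
  obtain ⟨b, hb, hbc⟩ := ComputablePred.computable_iff.1 h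
  refine ComputablePred.computable_iff.2
    ⟨fun c' => b (encode c'), hb.comp Computable.encode, funext fun c' => ?_⟩
  have hc' : eval c (encode c') = eval c' 0 := by
    simpa only [Denumerable.ofNat_encode] using congrFun hc (encode c')
  exact (congrArg Part.Dom hc').symm.trans (congrFun hbc (encode c'))

end ExRules

theorem mainTheorem6 :
    ¬ ExRules.DecidableOn ExRules.Instance.OverMSAPlusTrans ExRules.Instance.Entailed := by
  rintro ⟨f, hf, h⟩
  obtain ⟨c, hc⟩ := ExRules.exists_code_not_computablePred
  refine hc ?_
  -- All the instances lie in the promised class, so the partial algorithm is total along the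
  -- reduction.
  choose b hb hb' using fun n => h _ (ExRules.overMSAPlusTrans_evalInstance c n)
  have hcomp : Computable b :=
    (hf.comp (ExRules.primrec_evalInstance c).to_comp).of_eq fun n => Part.eq_some_iff.2 (hb n)
  refine ComputablePred.computable_iff.2 ⟨b, hcomp, funext fun n => propext ?_⟩
  exact Iff.trans ⟨ExRules.entailed_of_dom, ExRules.dom_of_entailed⟩ (hb' n).symm
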